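/- A \emph{general Dirichlet series} is a series $\sum_{n\ge 1} a_n e^{-\lambda_n s}$ with $a_n\in\mathbb{C}$, $\lambda_n\in\mathbb{R}$, for which the set of exponents $\{\lambda_n : a_n\neq 0\}$ is well ordered, i.e. each of its non-empty subsets has a least element (for example, $\lambda_n\to\infty$). Let $\mathcal{D}_s$ be the ring of all functions on the half-plane $\Re(s)>1/2$ that are sums of general Dirichlet series converging absolutely there. Let $L(s)$ be the sum, for $\Re(s)>1$, of a convergent general Dirichlet series which converges absolutely in some half-plane (this last condition is automatic for an ordinary Dirichlet series $\sum_{n\ge1} a_n n^{-s}$). Suppose that $L$ continues to a meromorphic function on $\Re(s)>1/2$ with finitely many poles, all of them on the line $\Re(s)=1$; that $L$ is of finite order, i.e. for all $1/2<\sigma_1<\sigma_2$ there is a real $A$ with $L(\sigma+it)=O(|t|^A)$ as $|t|\to\infty$, uniformly for $\sigma_1\le\sigma\le\sigma_2$; and that for each fixed $\sigma$ with $1/2<\sigma<1$ \[ \int_0^T |L(\sigma+it)|^2\,dt \ll T \qquad (T\to\infty). \] Let $P_s\in\mathcal{D}_s[X]$ be a polynomial such that the meromorphic function $P_s(L(s))$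 does not vanish identically on $\Re(s)>1/2$. Then for each $\sigma_0>1/2$ \[ N_{P(L)}(\sigma_0,T)\ll T \qquad (T\to\infty), \] where $N_{P(L)}(\sigma_0,T)$ is the number of zeros $\rho$, counted with multiplicity, of the meromorphic function $P_s(L(s))$ with $\Re(\rho)>\sigma_0$ and $0<\Im(\rho)<T$. The implied constant may depend on $L$, $P_s$ and $\sigma_0$. -/

import Mathlib

open Complex Filter Topology
open scoped ENNReal

/-- The open half-plane `Re s > 1/2`. -/
def rightHalfPlane : Set ℂ := {s | 1 / 2 < s.re}

/-- The `n`-th term `a_n e^{-λ_n s}` of a general Dirichlet series. -/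
noncomputable def gdsTerm (a : ℕ → ℂ) (lam : ℕ → ℝ) (s : ℂ) (n : ℕ) : ℂ :=
  a n * Complex.exp (-(lam n : ℂ) * s)

/-- The exponents that occur with a nonzero coefficient form a well-ordered set of reals, i.e. each
nonempty set of them has a least element. This holds in particular when `λ_n → ∞`. -/
def WellOrderedExponents (a : ℕ → ℂ) (lam : ℕ → ℝ) : Prop :=
  (lam '' Function.support a).IsWF

/-- On `Re s > 1/2` the function `f` is the sum of an absolutely convergent general Dirichlet
series: membership in the coefficient ring `𝓓_s`. (`HasSum` in `ℂ` is absolute convergence.) -/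
def IsAbsConvGDS (f : ℂ → ℂ) : Prop :=
  ∃ (a : ℕ → ℂ) (lam : ℕ → ℝ), WellOrderedExponents a lam ∧
    ∀ s ∈ rightHalfPlane, HasSum (gdsTerm a lam s) (f s)

/-- On `Re s > 1` the function `L` is the sum of a (general) Dirichlet series, in the sense of
convergence of partial sums, and the series converges absolutely in some half-plane.
For an ordinary Dirichlet series (`λ_n = log (n + 1)`) the last clause is automatic, since
convergence for `Re s > 1` gives absolute convergence for `Re s > 2`. -/
def IsDirichletSeriesRightOfOne (L : ℂ → ℂ) : Prop :=
  ∃ (a : ℕ → ℂ) (lam : ℕ → ℝ), WellOrderedExponents a lam ∧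
    (∀ s : ℂ, 1 < s.re →
      Tendsto (fun N : ℕ => ∑ n ∈ Finset.range N, gdsTerm a lam s n) atTop (𝓝 (L s))) ∧
    ∃ σa : ℝ, ∀ s : ℂ, σa < s.re → Summable (fun n => ‖gdsTerm a lam s n‖)

/-- `L` has finite order in `Re s > 1/2`: polynomial growth in `|Im s|`, uniformly in each closed
vertical strip of finite width inside the half-plane. -/
def HasFiniteOrder (L : ℂ → ℂ) : Prop :=
  ∀ σ₁ σ₂ : ℝ, 1 / 2 < σ₁ → ∃ A C t₀ : ℝ, ∀ s : ℂ,
    σ₁ ≤ s.re → s.re ≤ σ₂ → t₀ ≤ |s.im| → ‖L s‖ ≤ C * |s.im| ^ A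

/-- The function `s ↦ P_s(L(s))`. -/
noncomputable def polyComp (P : Polynomial (ℂ → ℂ)) (L : ℂ → ℂ) (s : ℂ) : ℂ :=
  (P.map (Pi.evalRingHom (fun _ : ℂ => ℂ) s)).eval (L s)

/-- Multiplicity of `ρ` as a zero of the meromorphic function `F`: the order of `F` at `ρ` if it is
nonnegative, `0` at a pole, and `⊤` if `F` vanishes identically near `ρ`. -/
noncomputable def zeroMult (F : ℂ → ℂ) (ρ : ℂ) : ℕ∞ :=
  WithTop.map Int.toNat (meromorphicOrderAt F ρ)

/-- Number of zeros `ρ` of `F`, with multiplicity, with `Re ρ > σ₀` and `0 < Im ρ < T`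
(the value is `∞` if there are infinitely many). -/
noncomputable def zeroCount (F : ℂ → ℂ) (σ₀ T : ℝ) : ℝ≥0∞ :=
  ∑' ρ : {ρ : ℂ // σ₀ < ρ.re ∧ 0 < ρ.im ∧ ρ.im < T}, ((zeroMult F ρ : ℕ∞) : ℝ≥0∞)

/-!
Jensen's formula in discs of fixed radius centred at `X + n * I` bounds the zeros of `P(L)` there by
the maximum of `log⁺ |P(L)|` on a slightly larger disc, minus `log |P(L)|` at the centre. Far to the
right `P(L)` is itself a general Dirichlet series, dominated by the term of least exponent, so for
`X` large the centre contributes `O(1)`. Since `log⁺ |P(L)| ≪ 1 + |L|`, it is enough to bound `|L|`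
on the discs; Cauchy's formula for `z ↦ L z * exp ((z - w) ^ 2)` on a large rectangle bounds `|L w|`
by a local mean of `|L|` on a vertical line slightly to the right of `Re s = 1 / 2`. The mean square
hypothesis makes the sum of these local means over `n < T` linear in `T`.
-/

/-- `f` is, far enough to the right, the sum of an absolutely convergent general Dirichlet series.
The series is encoded by its coefficient function `b : ℝ → ℂ` on the exponents, so that equal
exponents are already collected; `comap re atTop` expresses `Re s → ∞`, uniformly in `Im s`. -/
def IsEventuallyGDS (f : ℂ → ℂ) : Prop :=
  ∃ b : ℝ → ℂ, (Function.support b).IsPWO ∧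
    ∀ᶠ s in comap re atTop, HasSum (fun μ : ℝ => b μ * exp (-(μ : ℂ) * s)) (f s)

theorem eventually_comap_re_atTop {p : ℂ → Prop} :
    (∀ᶠ s in comap re atTop, p s) ↔ ∃ σ : ℝ, ∀ s : ℂ, σ < s.re → p s :=
  ((atTop_basis_Ioi.comap re).eventually_iff).trans (by simp)

theorem eventually_lt_re (σ : ℝ) : ∀ᶠ s : ℂ in comap re atTop, σ < s.re :=
  tendsto_comap.eventually (eventually_gt_atTop σ)

theorem norm_exp_neg_ofReal_mul (l : ℝ) (s : ℂ) :
    ‖exp (-(l : ℂ) * s)‖ = Real.exp (-l * s.re) := by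
  rw [Complex.norm_exp, ← ofReal_neg, re_ofReal_mul]

namespace IsEventuallyGDS

theorem of_hasSum {ι : Type*} {f : ℂ → ℂ} {a : ι → ℂ} {lam : ι → ℝ}
    (hlam : (lam '' Function.support a).IsPWO)
    (hf : ∀ᶠ s in comap re atTop, HasSum (fun i => a i * exp (-(lam i : ℂ) * s)) (f s)) :
    IsEventuallyGDS f := by
  refine ⟨fun μ => ∑' i : {i // lam i = μ}, a i, hlam.mono fun μ hμ => ?_, ?_⟩
  · by_contra hcon
    have hzero (i : {i // lam i = μ}) : a i = 0 := by
      by_contra hi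
      exact hcon ⟨i, hi, i.2⟩
    exact hμ (by simp only [hzero, tsum_zero])
  · filter_upwards [hf] with s hs
    have hsigma := (Equiv.sigmaFiberEquiv lam).hasSum_iff.2 hs
    refine (hsigma.sigma fun μ => (hsigma.summable.sigma_factor μ).hasSum).congr_fun fun μ => ?_
    rw [← tsum_mul_right]
    exact tsum_congr fun i => by rw [Function.comp_apply, Equiv.sigmaFiberEquiv_apply, i.2]

theorem add {f g : ℂ → ℂ} (hf : IsEventuallyGDS f) (hg : IsEventuallyGDS g) :
    IsEventuallyGDS (f + g) := by
  obtain ⟨b, hb, hfb⟩ := hf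
  obtain ⟨c, hc, hgc⟩ := hg
  refine ⟨b + c, (hb.union hc).mono (Function.support_add b c), ?_⟩
  filter_upwards [hfb, hgc] with s hf hg
  simpa only [Pi.add_apply, add_mul] using hf.add hg

theorem mul {f g : ℂ → ℂ} (hf : IsEventuallyGDS f) (hg : IsEventuallyGDS g) :
    IsEventuallyGDS (f * g) := by
  obtain ⟨b, hb, hfb⟩ := hf
  obtain ⟨c, hc, hgc⟩ := hg
  refine of_hasSum (a := fun p : ℝ × ℝ => b p.1 * c p.2) (lam := fun p => p.1 + p.2)
    ((hb.add hc).mono ?_) ?_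
  · rintro _ ⟨p, hp, rfl⟩
    exact Set.add_mem_add (left_ne_zero_of_mul hp) (right_ne_zero_of_mul hp)
  · filter_upwards [hfb, hgc] with s hf hg
    have hsum := summable_mul_of_summable_norm (f := fun μ : ℝ => b μ * exp (-(μ : ℂ) * s))
      (g := fun ν : ℝ => c ν * exp (-(ν : ℂ) * s)) hf.summable.norm hg.summable.norm
    refine (hf.mul hg hsum).congr_fun fun p => ?_
    rw [ofReal_add, neg_add, add_mul, Complex.exp_add]
    ring

end IsEventuallyGDS

/-- The functions that are eventually sums of general Dirichlet series, as a semiring. -/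
def eventualGDS : Subsemiring (ℂ → ℂ) where
  carrier := {f | IsEventuallyGDS f}
  zero_mem' := ⟨0, by simp [Function.support_zero], .of_forall fun s => by simp [hasSum_zero]⟩
  one_mem' := .of_hasSum (a := fun _ : Unit => 1) (lam := 0) (Set.toFinite _).isPWO
    (.of_forall fun s => by simp)
  add_mem' := .add
  mul_mem' := .mul

theorem IsAbsConvGDS.isEventuallyGDS {f : ℂ → ℂ} (hf : IsAbsConvGDS f) : IsEventuallyGDS f := by
  obtain ⟨a, lam, hlam, hf⟩ := hf
  exact .of_hasSum hlam.isPWO ((eventually_lt_re (1 / 2)).mono hf)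

theorem IsDirichletSeriesRightOfOne.isEventuallyGDS {L : ℂ → ℂ}
    (hL : IsDirichletSeriesRightOfOne L) : IsEventuallyGDS L := by
  obtain ⟨a, lam, hlam, hconv, σa, habs⟩ := hL
  refine .of_hasSum hlam.isPWO ?_
  filter_upwards [eventually_lt_re 1, eventually_lt_re σa] with s hs hsa
  have hsum : Summable (gdsTerm a lam s) := (habs s hsa).of_norm
  exact hsum.hasSum_iff_tendsto_nat.2 (hconv s hs)

namespace IsEventuallyGDS

-- After multiplication by `e^{μ₀ s}`, `μ₀` the least exponent, every other term tends to `0`.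
theorem exists_tendsto_exp_mul {f : ℂ → ℂ} (hf : IsEventuallyGDS f)
    (hne : ∃ᶠ s in comap re atTop, f s ≠ 0) :
    ∃ (μ₀ : ℝ) (c : ℂ), c ≠ 0 ∧
      Tendsto (fun s => exp (μ₀ * s) * f s) (comap re atTop) (𝓝 c) := by
  obtain ⟨b, hb, hfb⟩ := hf
  have hsupp : (Function.support b).Nonempty := by
    by_contra hempty
    obtain ⟨s, hs, hfs⟩ := (hne.and_eventually hfb).exists
    rw [Set.not_nonempty_iff_eq_empty, Function.support_eq_empty_iff] at hempty
    simp only [hempty, Pi.zero_apply, zero_mul] at hfs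
    exact hs (hfs.unique hasSum_zero)
  obtain ⟨σ, hσ⟩ := eventually_comap_re_atTop.1 hfb
  set μ₀ := hb.isWF.min hsupp
  have hmin (μ : ℝ) (hμ : b μ ≠ 0) : μ₀ ≤ μ := hb.isWF.min_le hsupp hμ
  refine ⟨μ₀, b μ₀, hb.isWF.min_mem hsupp, ?_⟩
  have hterm (μ : ℝ) (s : ℂ) :
      ‖b μ * exp (-((μ - μ₀ : ℝ) : ℂ) * s)‖ = ‖b μ‖ * Real.exp (-(μ - μ₀) * s.re) := by
    rw [norm_mul, norm_exp_neg_ofReal_mul]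
  have hseries {s : ℂ} (hs : σ < s.re) :
      HasSum (fun μ : ℝ => b μ * exp (-((μ - μ₀ : ℝ) : ℂ) * s)) (exp (μ₀ * s) * f s) := by
    refine ((hσ s hs).mul_left (exp (μ₀ * s))).congr_fun fun μ => ?_
    rw [mul_left_comm, ← Complex.exp_add]
    push_cast
    ring_nf
  have hlim : Tendsto (fun s : ℂ => ∑' μ : ℝ, b μ * exp (-((μ - μ₀ : ℝ) : ℂ) * s))
      (comap re atTop) (𝓝 (∑' μ : ℝ, if μ = μ₀ then b μ₀ else 0)) := by
    refine tendsto_tsum_of_dominated_convergence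
      (hseries (s := ((σ + 1 : ℝ) : ℂ)) (by simp)).summable.norm (fun μ => ?_) ?_
    · split_ifs with hμ
      · simpa [hμ] using tendsto_const_nhds
      by_cases hbμ : b μ = 0
      · simpa [hbμ] using tendsto_const_nhds
      have hlt : μ₀ < μ := (hmin μ hbμ).lt_of_ne' hμ
      rw [tendsto_zero_iff_norm_tendsto_zero]
      simp only [hterm]
      have hdecay : Tendsto (fun s : ℂ => Real.exp (-(μ - μ₀) * s.re)) (comap re atTop) (𝓝 0) :=
        Real.tendsto_exp_atBot.comp
          (tendsto_comap.const_mul_atTop_of_neg (neg_neg_of_pos (sub_pos.2 hlt)))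
      simpa only [mul_zero] using hdecay.const_mul ‖b μ‖
    · filter_upwards [eventually_lt_re (σ + 1)] with s hs μ
      rw [hterm, hterm, ofReal_re]
      by_cases hbμ : b μ = 0
      · simp [hbμ]
      gcongr ‖b μ‖ * Real.exp ?_
      nlinarith [hmin μ hbμ]
  rw [tsum_ite_eq] at hlim
  refine hlim.congr' ?_
  filter_upwards [eventually_lt_re σ] with s hs using (hseries hs).tsum_eq

theorem exists_lower_bound {f : ℂ → ℂ} (hf : IsEventuallyGDS f)
    (hne : ∃ᶠ s in comap re atTop, f s ≠ 0) :
    ∃ c μ : ℝ, 0 < c ∧ ∀ᶠ s : ℂ in comap re atTop, c * Real.exp (-μ * s.re) ≤ ‖f s‖ := by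
  obtain ⟨μ, c, hc, hlim⟩ := hf.exists_tendsto_exp_mul hne
  have hc' : 0 < ‖c‖ := norm_pos_iff.2 hc
  refine ⟨‖c‖ / 2, μ, half_pos hc', ?_⟩
  filter_upwards [hlim.norm.eventually_const_lt (half_lt_self hc')] with s hs
  rw [norm_mul, Complex.norm_exp, re_ofReal_mul] at hs
  calc ‖c‖ / 2 * Real.exp (-μ * s.re)
      ≤ (Real.exp (μ * s.re) * ‖f s‖) * Real.exp (-μ * s.re) := by gcongr
    _ = ‖f s‖ := by
      rw [mul_right_comm, ← Real.exp_add, neg_mul, add_neg_cancel, Real.exp_zero, one_mul]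

theorem eventually_bounded_on_line {f : ℂ → ℂ} (hf : IsEventuallyGDS f) :
    ∀ᶠ σ : ℝ in atTop, ∃ M : ℝ, ∀ s : ℂ, s.re = σ → ‖f s‖ ≤ M := by
  obtain ⟨b, -, hfb⟩ := hf
  obtain ⟨σ₁, hσ₁⟩ := eventually_comap_re_atTop.1 hfb
  filter_upwards [eventually_gt_atTop σ₁] with σ hσ
  have hsum := (hσ₁ σ hσ).summable.norm.hasSum
  refine ⟨∑' μ : ℝ, ‖b μ * exp (-(μ : ℂ) * σ)‖, fun s hs => ?_⟩
  rw [← (hσ₁ s (hs ▸ hσ)).tsum_eq]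
  refine tsum_of_norm_bounded hsum fun μ => le_of_eq ?_
  rw [norm_mul, norm_mul, norm_exp_neg_ofReal_mul, norm_exp_neg_ofReal_mul, hs, ofReal_re]

end IsEventuallyGDS

theorem exists_summable_bound_on_strip {ι : Type*} {a : ι → ℂ} {lam : ι → ℝ} {σ₁ σ₂ : ℝ}
    (h₁ : Summable fun i => a i * exp (-(lam i : ℂ) * σ₁))
    (h₂ : Summable fun i => a i * exp (-(lam i : ℂ) * σ₂)) :
    ∃ u : ι → ℝ, Summable u ∧ ∀ s : ℂ, σ₁ ≤ s.re → s.re ≤ σ₂ → ∀ i,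
      ‖a i * exp (-(lam i : ℂ) * s)‖ ≤ u i := by
  refine ⟨_, h₁.norm.add h₂.norm, fun s hs₁ hs₂ i => ?_⟩
  simp only [norm_mul, norm_exp_neg_ofReal_mul, ofReal_re, ← mul_add]
  gcongr
  rcases le_total 0 (lam i) with hl | hl
  · refine le_add_of_le_of_nonneg (Real.exp_le_exp.2 ?_) (Real.exp_pos _).le
    nlinarith
  · refine le_add_of_nonneg_of_le (Real.exp_pos _).le (Real.exp_le_exp.2 ?_)
    nlinarith

theorem IsAbsConvGDS.exists_bound_on_strip {f : ℂ → ℂ} (hf : IsAbsConvGDS f) {σ₁ : ℝ}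
    (hσ₁ : 1 / 2 < σ₁) (σ₂ : ℝ) :
    ∃ M : ℝ, ∀ s : ℂ, σ₁ ≤ s.re → s.re ≤ σ₂ → ‖f s‖ ≤ M := by
  rcases lt_or_ge σ₂ σ₁ with hlt | hle
  · exact ⟨0, fun s hs₁ hs₂ => absurd (hs₁.trans hs₂) hlt.not_ge⟩
  obtain ⟨a, lam, -, hsum⟩ := hf
  obtain ⟨u, hu, hbound⟩ := exists_summable_bound_on_strip (hsum σ₁ hσ₁).summable
    (hsum σ₂ (hσ₁.trans_le hle)).summable
  refine ⟨∑' i, u i, fun s hs₁ hs₂ => ?_⟩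
  rw [← (hsum s (hσ₁.trans_le hs₁)).tsum_eq]
  exact tsum_of_norm_bounded hu.hasSum (hbound s hs₁ hs₂)

theorem isOpen_rightHalfPlane : IsOpen rightHalfPlane := isOpen_lt continuous_const continuous_re

theorem IsAbsConvGDS.differentiableOn {f : ℂ → ℂ} (hf : IsAbsConvGDS f) :
    DifferentiableOn ℂ f rightHalfPlane := by
  obtain ⟨a, lam, -, hsum⟩ := hf
  intro s hs
  obtain ⟨σ₁, hσ₁, hσ₁s⟩ := exists_between (show 1 / 2 < s.re from hs)
  obtain ⟨u, hu, hbound⟩ := exists_summable_bound_on_strip (hsum σ₁ hσ₁).summable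
    (hsum ((s.re + 1 : ℝ) : ℂ) (hs.trans (lt_add_one s.re))).summable
  have hU : IsOpen {z : ℂ | σ₁ < z.re ∧ z.re < s.re + 1} :=
    (isOpen_lt continuous_const continuous_re).inter (isOpen_lt continuous_re continuous_const)
  have hdiff := differentiableOn_tsum_of_summable_norm hu
    (fun i => (by fun_prop : DifferentiableOn ℂ (fun z => a i * exp (-(lam i : ℂ) * z)) _)) hU
    (fun i z hz => hbound z hz.1.le hz.2.le i)
  refine ((hdiff.congr fun z hz => ?_).differentiableAt
    (hU.mem_nhds ⟨hσ₁s, lt_add_one s.re⟩)).differentiableWithinAt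
  exact (hsum z (hσ₁.trans hz.1)).tsum_eq.symm

section Rectangle

variable {a b c d : ℝ} {w : ℂ} {f : ℂ → ℂ}

/-- The integral of `f` along the positively oriented boundary of the rectangle
`[a, b] × [c, d]`. -/
noncomputable def rectIntegral (f : ℂ → ℂ) (a b c d : ℝ) : ℂ :=
  (∫ x in a..b, f (x + c * I)) - (∫ x in a..b, f (x + d * I))
    + I * (∫ y in c..d, f (b + y * I)) - I * ∫ y in c..d, f (a + y * I)

theorem mul_integral_inv_add_mul {u v : ℂ}
    (h : ∀ t ∈ Set.uIcc a b, u + (t : ℂ) * v ∈ slitPlane) :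
    v * ∫ t in a..b, (u + (t : ℂ) * v)⁻¹ = log (u + b * v) - log (u + a * v) := by
  rw [← intervalIntegral.integral_const_mul]
  refine intervalIntegral.integral_eq_sub_of_hasDerivAt (f := fun t : ℝ => log (u + t * v))
    (fun t ht => ?_) (ContinuousOn.intervalIntegrable ?_)
  · have hderiv : HasDerivAt (fun t : ℝ => u + (t : ℂ) * v) v t := by
      simpa using ((hasDerivAt_id t).ofReal_comp.mul_const v).const_add u
    simpa [div_eq_mul_inv] using hderiv.clog_real (h t ht)
  · exact continuousOn_const.mul
      (ContinuousOn.inv₀ (by fun_prop) fun t ht => slitPlane_ne_zero (h t ht))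

theorem log_sub_log_neg_of_im_pos {z : ℂ} (hz : 0 < z.im) : log z - log (-z) = Real.pi * I := by
  rw [log, log, norm_neg, arg_neg_eq_arg_sub_pi_of_im_pos hz]
  push_cast
  ring

theorem log_sub_log_neg_of_im_neg {z : ℂ} (hz : z.im < 0) : log z - log (-z) = -(Real.pi * I) := by
  rw [log, log, norm_neg, arg_neg_eq_arg_add_pi_of_im_neg hz]
  push_cast
  ring

theorem rectIntegral_inv_sub (ha : a < w.re) (hb : w.re < b) (hc : c < w.im) (hd : w.im < d) :
    rectIntegral (fun z => (z - w)⁻¹) a b c d = 2 * Real.pi * I := by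
  have horizontal (e : ℝ) (he : e ≠ w.im) : ∫ x in a..b, ((x : ℂ) + e * I - w)⁻¹ =
      log (b + e * I - w) - log (a + e * I - w) := by
    have h := mul_integral_inv_add_mul (a := a) (b := b) (u := e * I - w) (v := 1)
      fun t _ => .inr (by simpa using sub_ne_zero.2 he)
    simpa only [mul_one, one_mul, add_comm ((e : ℂ) * I - w), ← add_sub_assoc] using h
  have right : I * ∫ y in c..d, ((b : ℂ) + y * I - w)⁻¹ =
      log (b + d * I - w) - log (b + c * I - w) := by
    have h := mul_integral_inv_add_mul (a := c) (b := d) (u := b - w) (v := I)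
      fun t _ => .inl (by simpa using hb)
    simpa only [sub_add_eq_add_sub] using h
  have left : I * ∫ y in c..d, ((a : ℂ) + y * I - w)⁻¹ =
      log (-(a + d * I - w)) - log (-(a + c * I - w)) := by
    have h := mul_integral_inv_add_mul (a := c) (b := d) (u := -(a - w)) (v := -I)
      fun t _ => .inl (by simpa using ha)
    simpa only [mul_neg, ← neg_add, inv_neg, intervalIntegral.integral_neg, neg_mul, neg_neg,
      sub_add_eq_add_sub] using h
  have upper : log (a + d * I - w) - log (-(a + d * I - w)) = Real.pi * I :=
    log_sub_log_neg_of_im_pos (by simpa using hd)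
  have lower : log (a + c * I - w) - log (-(a + c * I - w)) = -(Real.pi * I) :=
    log_sub_log_neg_of_im_neg (by simpa using hc)
  rw [rectIntegral, horizontal c hc.ne, horizontal d hd.ne', right, left]
  linear_combination upper - lower

theorem integral_dslope_comp {γ : ℝ → ℂ} (hγ : ContinuousOn γ (Set.uIcc a b))
    (hf : ContinuousOn (fun t => f (γ t)) (Set.uIcc a b)) (hw : ∀ t ∈ Set.uIcc a b, γ t ≠ w) :
    ∫ t in a..b, dslope f w (γ t) =
      (∫ t in a..b, (γ t - w)⁻¹ * f (γ t)) - (∫ t in a..b, (γ t - w)⁻¹) * f w := by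
  have hinv : ContinuousOn (fun t => (γ t - w)⁻¹) (Set.uIcc a b) :=
    (hγ.sub continuousOn_const).inv₀ fun t ht => sub_ne_zero.2 (hw t ht)
  have hprod : IntervalIntegrable (fun t => (γ t - w)⁻¹ * f (γ t)) MeasureTheory.volume a b :=
    (hinv.mul hf).intervalIntegrable
  rw [← intervalIntegral.integral_mul_const,
    ← intervalIntegral.integral_sub hprod (hinv.intervalIntegrable.mul_const (f w))]
  refine intervalIntegral.integral_congr fun t ht => ?_
  rw [dslope_of_ne _ (hw t ht), slope_def_module, smul_eq_mul, mul_sub]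

theorem norm_integral_inv_sub_mul_le {γ : ℝ → ℂ} {δ : ℝ} (hab : a ≤ b) (hδ : 0 < δ)
    (hf : ContinuousOn (fun t => f (γ t)) (Set.uIcc a b)) (hw : ∀ t, δ ≤ ‖γ t - w‖) :
    ‖∫ t in a..b, (γ t - w)⁻¹ * f (γ t)‖ ≤ δ⁻¹ * ∫ t in a..b, ‖f (γ t)‖ := by
  rw [← intervalIntegral.integral_const_mul]
  refine intervalIntegral.norm_integral_le_of_norm_le hab (.of_forall fun t _ => ?_)
    (hf.norm.intervalIntegrable.const_mul _)
  rw [norm_mul, norm_inv]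
  gcongr
  exact hw t

theorem continuousOn_horizontal (hf : ContinuousOn f (Set.uIcc a b ×ℂ Set.uIcc c d)) {e : ℝ}
    (he : e ∈ Set.uIcc c d) : ContinuousOn (fun x : ℝ => f (x + e * I)) (Set.uIcc a b) :=
  hf.comp (by fun_prop) fun x hx => ⟨by simpa using hx, by simpa using he⟩

theorem continuousOn_vertical (hf : ContinuousOn f (Set.uIcc a b ×ℂ Set.uIcc c d)) {e : ℝ}
    (he : e ∈ Set.uIcc a b) : ContinuousOn (fun y : ℝ => f (e + y * I)) (Set.uIcc c d) :=
  hf.comp (by fun_prop) fun y hy => ⟨by simpa using he, by simpa using hy⟩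

-- The Cauchy-Goursat theorem applied to `dslope f w`.
theorem rectIntegral_inv_sub_mul (ha : a < w.re) (hb : w.re < b) (hc : c < w.im) (hd : w.im < d)
    (hf : DifferentiableOn ℂ f (Set.uIcc a b ×ℂ Set.uIcc c d)) :
    rectIntegral (fun z => (z - w)⁻¹ * f z) a b c d = 2 * Real.pi * I * f w := by
  have hw : Set.uIcc a b ×ℂ Set.uIcc c d ∈ 𝓝 w := by
    refine mem_of_superset ((isOpen_Ioo.reProdIm isOpen_Ioo).mem_nhds ⟨⟨ha, hb⟩, hc, hd⟩)
      (Set.inter_subset_inter ?_ ?_) <;>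
    exact Set.preimage_mono (Set.Ioo_subset_Icc_self.trans Set.Icc_subset_uIcc)
  have hzero : rectIntegral (dslope f w) a b c d = 0 := by
    simpa [rectIntegral] using integral_boundary_rect_eq_zero_of_differentiableOn (dslope f w)
      ((a : ℂ) + c * I) ((b : ℂ) + d * I) (by simpa using (differentiableOn_dslope hw).2 hf)
  have horizontal {e : ℝ} (he : e ∈ Set.uIcc c d) (hew : e ≠ w.im) := integral_dslope_comp (w := w)
    (by fun_prop) (continuousOn_horizontal hf.continuousOn he)
    fun t _ h => hew (by simpa using congrArg im h)
  have vertical {e : ℝ} (he : e ∈ Set.uIcc a b) (hew : e ≠ w.re) := integral_dslope_comp (w := w)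
    (by fun_prop) (continuousOn_vertical hf.continuousOn he)
    fun t _ h => hew (by simpa using congrArg re h)
  have hinv := rectIntegral_inv_sub ha hb hc hd
  rw [rectIntegral, horizontal Set.left_mem_uIcc hc.ne, horizontal Set.right_mem_uIcc hd.ne',
    vertical Set.left_mem_uIcc ha.ne, vertical Set.right_mem_uIcc hb.ne'] at hzero
  rw [rectIntegral] at hinv ⊢
  linear_combination hzero + f w * hinv

theorem two_pi_mul_norm_le_rect (ha : a < w.re) (hb : w.re < b) (hc : c < w.im) (hd : w.im < d)
    (hf : DifferentiableOn ℂ f (Set.uIcc a b ×ℂ Set.uIcc c d)) :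
    2 * Real.pi * ‖f w‖ ≤
      (w.im - c)⁻¹ * (∫ x in a..b, ‖f (x + c * I)‖) + (d - w.im)⁻¹ * (∫ x in a..b, ‖f (x + d * I)‖)
        + (b - w.re)⁻¹ * (∫ y in c..d, ‖f (b + y * I)‖)
        + (w.re - a)⁻¹ * ∫ y in c..d, ‖f (a + y * I)‖ := by
  have horizontal {e δ : ℝ} (he : e ∈ Set.uIcc c d) (hδ : 0 < δ) (hew : δ ≤ |e - w.im|) :=
    norm_integral_inv_sub_mul_le (w := w) (ha.trans hb).le hδ
      (continuousOn_horizontal hf.continuousOn he)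
      fun t => hew.trans (by simpa using abs_im_le_norm ((t : ℂ) + e * I - w))
  have vertical {e δ : ℝ} (he : e ∈ Set.uIcc a b) (hδ : 0 < δ) (hew : δ ≤ |e - w.re|) :=
    norm_integral_inv_sub_mul_le (w := w) (hc.trans hd).le hδ
      (continuousOn_vertical hf.continuousOn he)
      fun t => hew.trans (by simpa using abs_re_le_norm ((e : ℂ) + t * I - w))
  calc 2 * Real.pi * ‖f w‖ = ‖rectIntegral (fun z => (z - w)⁻¹ * f z) a b c d‖ := by
        rw [rectIntegral_inv_sub_mul ha hb hc hd hf]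
        simp [abs_of_pos Real.pi_pos]
    _ ≤ _ := (norm_sub_le _ _).trans (add_le_add_left ((norm_add_le _ _).trans
          (add_le_add_left (norm_sub_le _ _) _)) _)
    _ ≤ _ := by
        simp only [norm_mul, norm_I, one_mul]
        gcongr
        · exact horizontal Set.left_mem_uIcc (sub_pos.2 hc)
            ((le_abs_self _).trans_eq (abs_sub_comm _ _))
        · exact horizontal Set.right_mem_uIcc (sub_pos.2 hd) (le_abs_self _)
        · exact vertical Set.right_mem_uIcc (sub_pos.2 hb) (le_abs_self _)
        · exact vertical Set.left_mem_uIcc (sub_pos.2 ha)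
            ((le_abs_self _).trans_eq (abs_sub_comm _ _))

end Rectangle

section LocalMean

theorem norm_exp_sq (z : ℂ) : ‖exp (z ^ 2)‖ = Real.exp (z.re ^ 2 - z.im ^ 2) := by
  rw [Complex.norm_exp, sq, mul_re, sq, sq]

theorem norm_mul_exp_sub_sq_le {a b : ℝ} {w z : ℂ} (u : ℂ) (hw : w.re ∈ Set.Icc a b)
    (hz : z.re ∈ Set.Icc a b) :
    ‖u * exp ((z - w) ^ 2)‖ ≤ Real.exp ((b - a) ^ 2) * (‖u‖ * Real.exp (-(z.im - w.im) ^ 2)) := by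
  have hre : |z.re - w.re| ≤ b - a := by
    rw [abs_le]
    constructor <;> linarith [hz.1, hz.2, hw.1, hw.2]
  calc ‖u * exp ((z - w) ^ 2)‖
      = ‖u‖ * Real.exp ((z.re - w.re) ^ 2 + -(z.im - w.im) ^ 2) := by
        rw [norm_mul, norm_exp_sq, sub_re, sub_im, sub_eq_add_neg]
    _ ≤ ‖u‖ * Real.exp ((b - a) ^ 2 + -(z.im - w.im) ^ 2) := by
        gcongr ‖u‖ * Real.exp (?_ + _)
        exact sq_le_sq' (neg_le_of_abs_le hre) (le_of_abs_le hre)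
    _ = Real.exp ((b - a) ^ 2) * (‖u‖ * Real.exp (-(z.im - w.im) ^ 2)) := by
        rw [Real.exp_add, mul_left_comm]

-- Cauchy's formula for `z ↦ f z * exp ((z - w) ^ 2)`.
theorem norm_le_gaussian_rect {f : ℂ → ℂ} {a b c d : ℝ} {w : ℂ} (ha : a < w.re) (hb : w.re < b)
    (hc : c < w.im) (hd : w.im < d)
    (hf : DifferentiableOn ℂ f (Set.uIcc a b ×ℂ Set.uIcc c d)) :
    ‖f w‖ ≤ Real.exp ((b - a) ^ 2) *
      ((w.im - c)⁻¹ * (Real.exp (-(c - w.im) ^ 2) * ∫ x in a..b, ‖f (x + c * I)‖)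
        + (d - w.im)⁻¹ * (Real.exp (-(d - w.im) ^ 2) * ∫ x in a..b, ‖f (x + d * I)‖)
        + (b - w.re)⁻¹ * (∫ y in c..d, ‖f (b + y * I)‖ * Real.exp (-(y - w.im) ^ 2))
        + (w.re - a)⁻¹ * ∫ y in c..d, ‖f (a + y * I)‖ * Real.exp (-(y - w.im) ^ 2)) := by
  have hab : a ≤ b := (ha.trans hb).le
  have hcd : c ≤ d := (hc.trans hd).le
  set E := Real.exp ((b - a) ^ 2)
  set F : ℂ → ℂ := fun z => f z * exp ((z - w) ^ 2) with hF
  have hFdiff : DifferentiableOn ℂ F (Set.uIcc a b ×ℂ Set.uIcc c d) := hf.mul (by fun_prop)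
  have hle {z : ℂ} (hz : z.re ∈ Set.Icc a b) :
      ‖F z‖ ≤ E * (‖f z‖ * Real.exp (-(z.im - w.im) ^ 2)) :=
    norm_mul_exp_sub_sq_le (f z) ⟨ha.le, hb.le⟩ hz
  have horizontal {e : ℝ} (he : e ∈ Set.uIcc c d) : (∫ x in a..b, ‖F (x + e * I)‖) ≤
      E * (Real.exp (-(e - w.im) ^ 2) * ∫ x in a..b, ‖f (x + e * I)‖) := by
    rw [← intervalIntegral.integral_const_mul, ← intervalIntegral.integral_const_mul]
    refine intervalIntegral.integral_mono_on hab
      (continuousOn_horizontal hFdiff.continuousOn he).norm.intervalIntegrable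
      (((continuousOn_horizontal hf.continuousOn he).norm.intervalIntegrable.const_mul _).const_mul
        _) fun x hx => ?_
    simpa [mul_comm] using hle (z := x + e * I) (by simpa using hx)
  have vertical {e : ℝ} (he : e ∈ Set.Icc a b) : (∫ y in c..d, ‖F (e + y * I)‖) ≤
      E * ∫ y in c..d, ‖f (e + y * I)‖ * Real.exp (-(y - w.im) ^ 2) := by
    rw [← Set.uIcc_of_le hab] at he
    rw [← intervalIntegral.integral_const_mul]
    refine intervalIntegral.integral_mono_on hcd
      (continuousOn_vertical hFdiff.continuousOn he).norm.intervalIntegrable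
      (((continuousOn_vertical hf.continuousOn he).norm.mul
        (by fun_prop)).intervalIntegrable.const_mul _) fun y _ => ?_
    rw [Set.uIcc_of_le hab] at he
    simpa using hle (z := e + y * I) (by simpa using he)
  have hFw : ‖F w‖ = ‖f w‖ := by simp [hF]
  calc ‖f w‖ ≤ 2 * Real.pi * ‖F w‖ := by
        rw [hFw]
        exact le_mul_of_one_le_left (norm_nonneg _) (by linarith [Real.pi_gt_three])
    _ ≤ _ := two_pi_mul_norm_le_rect ha hb hc hd hFdiff
    _ ≤ (w.im - c)⁻¹ * (E * (Real.exp (-(c - w.im) ^ 2) * ∫ x in a..b, ‖f (x + c * I)‖))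
        + (d - w.im)⁻¹ * (E * (Real.exp (-(d - w.im) ^ 2) * ∫ x in a..b, ‖f (x + d * I)‖))
        + (b - w.re)⁻¹ * (E * ∫ y in c..d, ‖f (b + y * I)‖ * Real.exp (-(y - w.im) ^ 2))
        + (w.re - a)⁻¹ * (E * ∫ y in c..d, ‖f (a + y * I)‖ * Real.exp (-(y - w.im) ^ 2)) := by
        have := sub_pos.2 ha
        have := sub_pos.2 hb
        have := sub_pos.2 hc
        have := sub_pos.2 hd
        gcongr
        · exact horizontal Set.left_mem_uIcc
        · exact horizontal Set.right_mem_uIcc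
        · exact vertical (Set.right_mem_Icc.2 hab)
        · exact vertical (Set.left_mem_Icc.2 hab)
    _ = _ := by ring

theorem eventually_exp_mul_integral_le_one {f : ℂ → ℂ} {a b A C τ : ℝ} (hab : a ≤ b)
    (hgrowth : ∀ s : ℂ, a ≤ s.re → s.re ≤ b → τ ≤ s.im → ‖f s‖ ≤ C * s.im ^ A) :
    ∀ᶠ e : ℝ in atTop, ∀ v : ℝ, e / 6 ≤ |e - v| →
      Real.exp (-(e - v) ^ 2) * ∫ x in a..b, ‖f (x + e * I)‖ ≤ 1 := by
  have hlim : Tendsto (fun e : ℝ => C * (b - a) * (e ^ A * Real.exp (-(1 / 36) * e ^ 2)))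
      atTop (𝓝 0) := by
    have hexp : Tendsto (fun e : ℝ => Real.exp (-(1 / 2) * e)) atTop (𝓝 0) :=
      Real.tendsto_exp_atBot.comp (tendsto_id.const_mul_atTop_of_neg (by norm_num))
    simpa only [mul_zero] using ((rpow_mul_exp_neg_mul_sq_isLittleO_exp_neg
      (by norm_num : (0 : ℝ) < 1 / 36) A).isBigO.trans_tendsto hexp).const_mul (C * (b - a))
  filter_upwards [hlim.eventually_le_const one_pos, eventually_ge_atTop τ, eventually_gt_atTop 0]
    with e hsmall hτ he v hv
  have hedge : ∫ x in a..b, ‖f (x + e * I)‖ ≤ C * e ^ A * (b - a) := by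
    rw [← abs_of_nonneg (sub_nonneg.2 hab)]
    refine (Real.le_norm_self _).trans
      (intervalIntegral.norm_integral_le_of_norm_le_const fun x hx => ?_)
    rw [Set.uIoc_of_le hab] at hx
    simpa using hgrowth (x + e * I) (by simpa using hx.1.le) (by simpa using hx.2)
      (by simpa using hτ)
  have hgauss : Real.exp (-(e - v) ^ 2) ≤ Real.exp (-(1 / 36) * e ^ 2) := by
    refine Real.exp_le_exp.2 ?_
    nlinarith [sq_abs (e - v)]
  calc Real.exp (-(e - v) ^ 2) * ∫ x in a..b, ‖f (x + e * I)‖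
      ≤ Real.exp (-(1 / 36) * e ^ 2) * ∫ x in a..b, ‖f (x + e * I)‖ := by
        gcongr
        exact intervalIntegral.integral_nonneg hab fun x _ => norm_nonneg _
    _ ≤ Real.exp (-(1 / 36) * e ^ 2) * (C * e ^ A * (b - a)) := by gcongr
    _ = C * (b - a) * (e ^ A * Real.exp (-(1 / 36) * e ^ 2)) := by ring
    _ ≤ 1 := hsmall

/-- The mean of `g` around the height `x > 0`, with exponentially decaying weight. Truncating to
`[x / 2, 3 / 2 * x]` keeps away from the poles near the real axis. -/
noncomputable def localMean (g : ℝ → ℝ) (x : ℝ) : ℝ :=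
  ∫ y in (x / 2)..(3 / 2 * x), g y * Real.exp (-|y - x|)

theorem localMean_nonneg {g : ℝ → ℝ} (hg : ∀ y, 0 ≤ g y) {x : ℝ} (hx : 0 ≤ x) :
    0 ≤ localMean g x :=
  intervalIntegral.integral_nonneg (by linarith) fun y _ => mul_nonneg (hg y) (Real.exp_pos _).le

theorem integral_gaussian_le_localMean {u g : ℝ → ℝ} {x v h M : ℝ} (hx : 0 ≤ x) (hv : |v - x| ≤ h)
    (hu : ContinuousOn u (Set.uIcc (x / 2) (3 / 2 * x))) (hg : Continuous g) (hg₀ : ∀ y, 0 ≤ g y)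
    (hM : 0 ≤ M) (hug : ∀ y, u y ≤ M * g y) :
    ∫ y in (x / 2)..(3 / 2 * x), u y * Real.exp (-(y - v) ^ 2)
      ≤ M * Real.exp (1 / 4 + h) * localMean g x := by
  rw [localMean, ← intervalIntegral.integral_const_mul]
  refine intervalIntegral.integral_mono_on (by linarith)
    (hu.mul (by fun_prop)).intervalIntegrable
    (Continuous.intervalIntegrable (by fun_prop) _ _) fun y _ => ?_
  have hexp : -(y - v) ^ 2 ≤ 1 / 4 + h + -|y - x| := by
    have htri : |y - x| ≤ |y - v| + |v - x| := abs_sub_le _ _ _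
    nlinarith [sq_nonneg (|y - v| - 1 / 2), sq_abs (y - v)]
  have hMg : 0 ≤ M * g y := mul_nonneg hM (hg₀ y)
  calc u y * Real.exp (-(y - v) ^ 2)
      ≤ M * g y * Real.exp (1 / 4 + h + -|y - x|) := by gcongr; exact hug y
    _ = M * Real.exp (1 / 4 + h) * (g y * Real.exp (-|y - x|)) := by rw [Real.exp_add]; ring

theorem norm_le_localMean {f : ℂ → ℂ} {a b x h M : ℝ} {w : ℂ} (ha : a < w.re) (hb : w.re < b)
    (hw : |w.im - x| ≤ h) (hxh : 2 * h + 2 ≤ x)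
    (hf : DifferentiableOn ℂ f (Set.uIcc a b ×ℂ Set.uIcc (x / 2) (3 / 2 * x)))
    (hbottom : Real.exp (-(x / 2 - w.im) ^ 2) * ∫ t in a..b, ‖f (t + (x / 2 : ℝ) * I)‖ ≤ 1)
    (htop : Real.exp (-(3 / 2 * x - w.im) ^ 2) * ∫ t in a..b, ‖f (t + (3 / 2 * x : ℝ) * I)‖ ≤ 1)
    (hleft : Continuous fun y : ℝ => f (a + y * I)) (hright : ∀ y : ℝ, ‖f (b + y * I)‖ ≤ M) :
    ‖f w‖ ≤ Real.exp ((b - a) ^ 2) * (2 + ((b - w.re)⁻¹ * M + (w.re - a)⁻¹) *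
      Real.exp (1 / 4 + h) * localMean (fun y => ‖f (a + y * I)‖ + 1) x) := by
  set g : ℝ → ℝ := fun y => ‖f (a + y * I)‖ + 1
  have hg : Continuous g := hleft.norm.add continuous_const
  have hg₁ (y : ℝ) : 1 ≤ g y := le_add_of_nonneg_left (norm_nonneg _)
  have hg₀ (y : ℝ) : 0 ≤ g y := zero_le_one.trans (hg₁ y)
  have hM : 0 ≤ M := (norm_nonneg _).trans (hright 0)
  obtain ⟨hlow, hup⟩ := abs_le.1 hw
  have hx : 0 ≤ x := by linarith
  have hab : a ≤ b := (ha.trans hb).le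
  have hright' := integral_gaussian_le_localMean hx hw
    (continuousOn_vertical hf.continuousOn Set.right_mem_uIcc).norm hg hg₀ hM
    fun y => (hright y).trans (le_mul_of_one_le_right hM (hg₁ y))
  have hleft' := integral_gaussian_le_localMean hx hw
    (continuousOn_vertical hf.continuousOn Set.left_mem_uIcc).norm hg hg₀ zero_le_one
    fun y => (le_add_of_nonneg_right zero_le_one).trans_eq (one_mul _).symm
  have hnonneg {e : ℝ} {u : ℝ → ℂ} : 0 ≤ Real.exp (-(e - w.im) ^ 2) * ∫ t in a..b, ‖u t‖ :=
    mul_nonneg (Real.exp_pos _).le (intervalIntegral.integral_nonneg hab fun _ _ => norm_nonneg _)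
  have ha' : 0 < w.re - a := sub_pos.2 ha
  have hb' : 0 < b - w.re := sub_pos.2 hb
  calc ‖f w‖ ≤ _ := norm_le_gaussian_rect ha hb (by linarith) (by linarith) hf
    _ ≤ Real.exp ((b - a) ^ 2) * (1 * 1 + 1 * 1
        + (b - w.re)⁻¹ * (M * Real.exp (1 / 4 + h) * localMean g x)
        + (w.re - a)⁻¹ * (1 * Real.exp (1 / 4 + h) * localMean g x)) := by
        gcongr
        · exact hnonneg
        · exact inv_le_one_of_one_le₀ (by linarith)
        · exact hnonneg
        · exact inv_le_one_of_one_le₀ (by linarith)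
    _ = _ := by ring

theorem exists_norm_le_localMean {f : ℂ → ℂ} {a b σ₁ σ₂ τ A C M : ℝ} (hab : a < b) (ha : a < σ₁)
    (hb : σ₂ < b)
    (hdiff : ∀ s : ℂ, a ≤ s.re → s.re ≤ b → τ ≤ s.im → DifferentiableAt ℂ f s)
    (hgrowth : ∀ s : ℂ, a ≤ s.re → s.re ≤ b → τ ≤ s.im → ‖f s‖ ≤ C * s.im ^ A)
    (hleft : Continuous fun y : ℝ => f (a + y * I)) (hright : ∀ y : ℝ, ‖f (b + y * I)‖ ≤ M)
    (h : ℝ) :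
    ∃ K : ℝ, 0 ≤ K ∧ ∀ᶠ x : ℝ in atTop, ∀ w : ℂ, σ₁ ≤ w.re → w.re ≤ σ₂ → |w.im - x| ≤ h →
      ‖f w‖ ≤ K * (1 + localMean (fun y => ‖f (a + y * I)‖ + 1) x) := by
  have hM : 0 ≤ M := (norm_nonneg _).trans (hright 0)
  set E := Real.exp ((b - a) ^ 2)
  set D := ((b - σ₂)⁻¹ * M + (σ₁ - a)⁻¹) * Real.exp (1 / 4 + h) with hD
  have hD₀ : 0 ≤ D := mul_nonneg (add_nonneg (mul_nonneg (inv_nonneg.2 (sub_nonneg.2 hb.le)) hM)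
    (inv_nonneg.2 (sub_nonneg.2 ha.le))) (Real.exp_pos _).le
  have hsmall := eventually_exp_mul_integral_le_one hab.le hgrowth
  refine ⟨E * (2 + D), by positivity, ?_⟩
  filter_upwards [(tendsto_id.atTop_div_const two_pos).eventually hsmall,
    (tendsto_id.const_mul_atTop (by norm_num : (0 : ℝ) < 3 / 2)).eventually hsmall,
    eventually_ge_atTop (2 * τ), eventually_ge_atTop (4 * h), eventually_ge_atTop (2 * h + 2),
    eventually_ge_atTop 0] with x hbottom htop hxτ hxh hxh' hx w hw₁ hw₂ hw
  obtain ⟨hlow, hup⟩ := abs_le.1 hw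
  set J := localMean (fun y => ‖f (a + y * I)‖ + 1) x
  have hJ : 0 ≤ J := localMean_nonneg (fun y => by positivity) hx
  have hf : DifferentiableOn ℂ f (Set.uIcc a b ×ℂ Set.uIcc (x / 2) (3 / 2 * x)) := by
    rw [Set.uIcc_of_le hab.le, Set.uIcc_of_le (by linarith)]
    exact fun s hs =>
      (hdiff s hs.1.1 hs.1.2 (by linarith [hs.2.1])).differentiableWithinAt
  calc ‖f w‖ ≤ E * (2 + ((b - w.re)⁻¹ * M + (w.re - a)⁻¹) * Real.exp (1 / 4 + h) * J) :=
        norm_le_localMean (ha.trans_le hw₁) (hw₂.trans_lt hb) hw hxh' hf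
          (hbottom w.im (by rw [id, abs_of_nonpos] <;> linarith))
          (htop w.im (by rw [id, abs_of_nonneg] <;> linarith)) hleft hright
    _ ≤ E * (2 + D * J) := by rw [hD]; gcongr
    _ ≤ E * ((2 + D) * (1 + J)) := by gcongr; nlinarith
    _ = E * (2 + D) * (1 + J) := by ring

theorem exists_sum_exp_neg_abs_sub_le :
    ∃ B : ℝ, ∀ (u : ℝ) (t : Finset ℕ), ∑ n ∈ t, Real.exp (-|u - n|) ≤ B := by
  have hsummable : Summable fun j : ℤ => Real.exp (-|(j : ℝ)|) :=
    .of_nat_of_neg (by simpa using Real.summable_exp_neg_nat)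
      (by simpa using Real.summable_exp_neg_nat)
  refine ⟨Real.exp 1 * ∑' j : ℤ, Real.exp (-|(j : ℝ)|), fun u t => ?_⟩
  have hinj : Function.Injective fun n : ℕ => ⌊u⌋ - (n : ℤ) :=
    sub_right_injective.comp Nat.cast_injective
  have hfloor (n : ℕ) : -|u - n| ≤ 1 + -|((⌊u⌋ - (n : ℤ) : ℤ) : ℝ)| := by
    have htri : |(⌊u⌋ : ℝ) - n| ≤ |(⌊u⌋ : ℝ) - u| + |u - n| := abs_sub_le _ _ _
    have hone : |(⌊u⌋ : ℝ) - u| ≤ 1 := by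
      rw [abs_le]
      constructor <;> linarith [Int.floor_le u, Int.lt_floor_add_one u]
    push_cast
    linarith
  calc ∑ n ∈ t, Real.exp (-|u - n|)
      ≤ ∑ n ∈ t, Real.exp 1 * Real.exp (-|((⌊u⌋ - (n : ℤ) : ℤ) : ℝ)|) :=
        Finset.sum_le_sum fun n _ => by
          rw [← Real.exp_add]
          exact Real.exp_le_exp.2 (hfloor n)
    _ = Real.exp 1 * ∑ n ∈ t, Real.exp (-|((⌊u⌋ - (n : ℤ) : ℤ) : ℝ)|) := (Finset.mul_sum ..).symm
    _ ≤ Real.exp 1 * ∑' j : ℤ, Real.exp (-|(j : ℝ)|) := by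
        gcongr
        exact ((hsummable.comp_injective hinj).sum_le_tsum t fun _ _ => (Real.exp_pos _).le).trans
          (tsum_comp_le_tsum_of_inj hsummable (fun j => (Real.exp_pos _).le) hinj)

theorem exists_sum_localMean_le :
    ∃ B : ℝ, ∀ g : ℝ → ℝ, Continuous g → (∀ y, 0 ≤ g y) → ∀ N : ℕ,
      ∑ n ∈ Finset.range N, localMean g n ≤ B * ∫ y in (0 : ℝ)..(2 * N), g y := by
  obtain ⟨B, hsum⟩ := exists_sum_exp_neg_abs_sub_le
  refine ⟨B, fun g hg hg₀ N => ?_⟩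
  have hcont (n : ℕ) : Continuous fun y : ℝ => g y * Real.exp (-|y - n|) := by fun_prop
  calc ∑ n ∈ Finset.range N, localMean g n
      ≤ ∑ n ∈ Finset.range N, ∫ y in (0 : ℝ)..(2 * N), g y * Real.exp (-|y - n|) := by
        refine Finset.sum_le_sum fun n hn => ?_
        have hn' : (n : ℝ) ≤ N := by exact_mod_cast (Finset.mem_range.1 hn).le
        have hn₀ : (0 : ℝ) ≤ n := n.cast_nonneg
        exact intervalIntegral.integral_mono_interval (by linarith) (by linarith) (by linarith)
          (.of_forall fun y => mul_nonneg (hg₀ y) (Real.exp_pos _).le)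
          ((hcont n).intervalIntegrable _ _)
    _ = ∫ y in (0 : ℝ)..(2 * N), ∑ n ∈ Finset.range N, g y * Real.exp (-|y - n|) :=
        (intervalIntegral.integral_finsetSum fun n _ => (hcont n).intervalIntegrable _ _).symm
    _ ≤ ∫ y in (0 : ℝ)..(2 * N), B * g y := by
        refine intervalIntegral.integral_mono_on (by positivity)
          ((continuous_finsetSum _ fun n _ => hcont n).intervalIntegrable _ _)
          ((hg.const_mul B).intervalIntegrable _ _) fun y _ => ?_
        rw [← Finset.mul_sum, mul_comm B]
        exact mul_le_mul_of_nonneg_left (hsum y _) (hg₀ y)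
    _ = B * ∫ y in (0 : ℝ)..(2 * N), g y := intervalIntegral.integral_const_mul _ _

theorem sum_localMean_isBigO {g : ℝ → ℝ} (hg : Continuous g) (hg₀ : ∀ y, 0 ≤ g y)
    (hmean : (fun T : ℝ => ∫ y in (0 : ℝ)..T, g y) =O[atTop] fun T => T) :
    (fun N : ℕ => ∑ n ∈ Finset.range N, localMean g n) =O[atTop] fun N => (N : ℝ) := by
  obtain ⟨B, hsum⟩ := exists_sum_localMean_le
  have htwo : Tendsto (fun N : ℕ => 2 * (N : ℝ)) atTop atTop :=
    tendsto_natCast_atTop_atTop.const_mul_atTop two_pos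
  calc (fun N : ℕ => ∑ n ∈ Finset.range N, localMean g n)
      =O[atTop] fun N : ℕ => B * ∫ y in (0 : ℝ)..(2 * N), g y := by
        refine .of_norm_le fun N => ?_
        rw [Real.norm_of_nonneg (Finset.sum_nonneg fun n _ => localMean_nonneg hg₀ n.cast_nonneg)]
        exact hsum g hg hg₀ N
    _ =O[atTop] fun N : ℕ => 2 * (N : ℝ) := (hmean.comp_tendsto htwo).const_mul_left B
    _ =O[atTop] fun N : ℕ => (N : ℝ) := (Asymptotics.isBigO_refl _ _).const_mul_left 2

end LocalMean

/-- On the strip `σ₁ ≤ Re w ≤ σ₂`, `u w` is bounded in the window `|Im w - n| ≤ h` by some `B n`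
whose sum over `n < N` is `O(N)`; the windows near the real axis are exempt. -/
def BoundedOnAverage (u : ℂ → ℝ) (σ₁ σ₂ h : ℝ) : Prop :=
  ∃ B : ℕ → ℝ, (∀ n, 0 ≤ B n) ∧
    ((fun N : ℕ => ∑ n ∈ Finset.range N, B n) =O[atTop] fun N => (N : ℝ)) ∧
    ∀ᶠ n : ℕ in atTop, ∀ w : ℂ, σ₁ ≤ w.re → w.re ≤ σ₂ → |w.im - n| ≤ h → u w ≤ B n

theorem sum_add_mul_isBigO {B : ℕ → ℝ}
    (hB : (fun N : ℕ => ∑ n ∈ Finset.range N, B n) =O[atTop] fun N => (N : ℝ)) (A D : ℝ) :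
    (fun N : ℕ => ∑ n ∈ Finset.range N, (A + D * B n)) =O[atTop] fun N => (N : ℝ) := by
  simp only [Finset.sum_add_distrib, Finset.sum_const, Finset.card_range, nsmul_eq_mul,
    ← Finset.mul_sum]
  refine .add ?_ (hB.const_mul_left D)
  simpa only [mul_comm] using (Asymptotics.isBigO_refl (fun N : ℕ => (N : ℝ)) _).const_mul_left A

theorem BoundedOnAverage.of_le_add_mul {u v : ℂ → ℝ} {σ₁ σ₂ h A D : ℝ}
    (hv : BoundedOnAverage v σ₁ σ₂ h) (hA : 0 ≤ A) (hD : 0 ≤ D)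
    (huv : ∀ w : ℂ, σ₁ ≤ w.re → w.re ≤ σ₂ → u w ≤ A + D * v w) : BoundedOnAverage u σ₁ σ₂ h := by
  obtain ⟨B, hB, hsum, hbound⟩ := hv
  refine ⟨fun n => A + D * B n, fun n => add_nonneg hA (mul_nonneg hD (hB n)),
    sum_add_mul_isBigO hsum A D, ?_⟩
  filter_upwards [hbound] with n hn w h₁ h₂ hw
  exact (huv w h₁ h₂).trans (by gcongr; exact hn w h₁ h₂ hw)

section Growth

variable {L : ℂ → ℂ} {S : Finset ℂ}

theorem isOpen_rightHalfPlane_diff (S : Finset ℂ) : IsOpen (rightHalfPlane \ (S : Set ℂ)) :=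
  isOpen_rightHalfPlane.sdiff S.finite_toSet.isClosed

theorem continuous_verticalLine (hhol : DifferentiableOn ℂ L (rightHalfPlane \ (S : Set ℂ)))
    {σ : ℝ} (hσ : 1 / 2 < σ) (hS : ∀ s ∈ S, s.re ≠ σ) :
    Continuous fun y : ℝ => L (σ + y * I) :=
  hhol.continuousOn.comp_continuous (by fun_prop) fun y =>
    ⟨by simpa [rightHalfPlane] using hσ, fun hy => hS _ hy (by simp)⟩

theorem eventually_forall_re_ne (S : Finset ℂ) (a : ℝ) :
    ∀ᶠ σ : ℝ in 𝓝[>] a, ∀ s ∈ S, s.re ≠ σ := by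
  filter_upwards [nhdsGT_le_nhdsNE a
    (nhdsNE_le_cofinite _ (S.finite_toSet.image re).compl_mem_cofinite)] with σ hσ s hs hsσ
  exact hσ ⟨s, hs, hsσ⟩

theorem boundedOnAverage_norm (hL : IsEventuallyGDS L)
    (hhol : DifferentiableOn ℂ L (rightHalfPlane \ (S : Set ℂ))) (hord : HasFiniteOrder L)
    (hmean : ∃ᶠ σ : ℝ in 𝓝[>] (1 / 2),
      (fun T : ℝ => ∫ t in (0 : ℝ)..T, ‖L ((σ : ℂ) + (t : ℂ) * I)‖) =O[atTop] fun T => T)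
    {σ₁ : ℝ} (hσ₁ : 1 / 2 < σ₁) (σ₂ h : ℝ) :
    BoundedOnAverage (fun s => ‖L s‖) σ₁ σ₂ h := by
  obtain ⟨a, hmean, ⟨ha, haσ₁⟩, haS⟩ := (hmean.and_eventually
    (.and (Ioo_mem_nhdsGT hσ₁) (eventually_forall_re_ne S (1 / 2)))).exists
  obtain ⟨b, ⟨M, hM⟩, hab, hσ₂b⟩ := (hL.eventually_bounded_on_line.and
    ((eventually_gt_atTop a).and (eventually_gt_atTop σ₂))).exists
  obtain ⟨A, C, t₀, hgrowth⟩ := hord a b ha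
  obtain ⟨τ, hτS, hτt₀, hτ⟩ := (((Finset.eventually_all S).2
    fun s _ => eventually_gt_atTop s.im).and
      ((eventually_ge_atTop t₀).and (eventually_ge_atTop 0))).exists
  have hcont := continuous_verticalLine hhol ha haS
  obtain ⟨K, hK, hbound⟩ := exists_norm_le_localMean (f := L) (τ := τ) hab haσ₁ hσ₂b
    (fun s h₁ _ him => hhol.differentiableAt ((isOpen_rightHalfPlane_diff S).mem_nhds
      ⟨ha.trans_le h₁, fun hs => (hτS s hs).not_ge him⟩))
    (fun s h₁ h₂ him => by
      have him₀ := abs_of_nonneg (hτ.trans him)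
      simpa only [him₀] using hgrowth s h₁ h₂ (him₀.symm ▸ hτt₀.trans him))
    hcont (fun y => hM _ (by simp)) h
  set g : ℝ → ℝ := fun y => ‖L (a + y * I)‖ + 1
  have hg : Continuous g := hcont.norm.add continuous_const
  have hg₀ (y : ℝ) : 0 ≤ g y := by positivity
  have hgmean : (fun T : ℝ => ∫ y in (0 : ℝ)..T, g y) =O[atTop] fun T => T := by
    refine (hmean.add (Asymptotics.isBigO_refl _ _)).congr_left fun T => ?_
    rw [intervalIntegral.integral_add (hcont.norm.intervalIntegrable _ _)
      intervalIntegrable_const]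
    simp
  refine ⟨fun n => K + K * localMean g n, fun n => ?_,
    sum_add_mul_isBigO (sum_localMean_isBigO hg hg₀ hgmean) K K, ?_⟩
  · exact add_nonneg hK (mul_nonneg hK (localMean_nonneg hg₀ n.cast_nonneg))
  · filter_upwards [tendsto_natCast_atTop_atTop.eventually hbound] with n hn w h₁ h₂ hw
    exact (hn w h₁ h₂ hw).trans_eq (by ring)

end Growth

section PolyComp

open scoped Real

variable {P : Polynomial (ℂ → ℂ)} {L : ℂ → ℂ}

theorem polyComp_eq_eval (P : Polynomial (ℂ → ℂ)) (L : ℂ → ℂ) : polyComp P L = P.eval L := by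
  funext s
  rw [polyComp, Polynomial.eval_map]
  exact Polynomial.eval₂_at_apply (Pi.evalRingHom (fun _ : ℂ => ℂ) s) L

theorem polyComp_eq_sum (P : Polynomial (ℂ → ℂ)) (L : ℂ → ℂ) :
    polyComp P L = ∑ k ∈ Finset.range (P.natDegree + 1), P.coeff k * L ^ k := by
  rw [polyComp_eq_eval, Polynomial.eval_eq_sum_range]

theorem differentiableOn_polyComp (hP : ∀ k, IsAbsConvGDS (P.coeff k)) {U : Set ℂ}
    (hU : U ⊆ rightHalfPlane) (hL : DifferentiableOn ℂ L U) :
    DifferentiableOn ℂ (polyComp P L) U := by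
  rw [polyComp_eq_sum]
  exact DifferentiableOn.sum fun k _ => ((hP k).differentiableOn.mono hU).mul (hL.pow k)

theorem meromorphicOn_polyComp (hP : ∀ k, IsAbsConvGDS (P.coeff k))
    (hL : MeromorphicOn L rightHalfPlane) : MeromorphicOn (polyComp P L) rightHalfPlane := by
  rw [polyComp_eq_sum]
  refine fun z hz => MeromorphicAt.sum fun k _ => .mul ?_ ((hL z hz).pow k)
  exact ((hP k).differentiableOn.analyticAt (isOpen_rightHalfPlane.mem_nhds hz)).meromorphicAt

theorem IsEventuallyGDS.polyComp (hP : ∀ k, IsAbsConvGDS (P.coeff k)) (hL : IsEventuallyGDS L) :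
    IsEventuallyGDS (polyComp P L) := by
  rw [polyComp_eq_sum]
  exact sum_mem (S := eventualGDS) fun k _ =>
    mul_mem (hP k).isEventuallyGDS (pow_mem (S := eventualGDS) hL k)

theorem BoundedOnAverage.posLog_norm_polyComp (hP : ∀ k, IsAbsConvGDS (P.coeff k)) {σ₁ σ₂ h : ℝ}
    (hσ₁ : 1 / 2 < σ₁) (hL : BoundedOnAverage (fun s => ‖L s‖) σ₁ σ₂ h) :
    BoundedOnAverage (fun s => log⁺ ‖polyComp P L s‖) σ₁ σ₂ h := by
  choose M hM using fun k => (hP k).exists_bound_on_strip hσ₁ σ₂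
  set J := Finset.range (P.natDegree + 1)
  refine hL.of_le_add_mul (A := Real.log J.card + ∑ k ∈ J, log⁺ (M k)) (D := ∑ k ∈ J, (k : ℝ))
    (add_nonneg (Real.log_natCast_nonneg _) (Finset.sum_nonneg fun k _ => Real.posLog_nonneg))
    (by positivity) fun s h₁ h₂ => ?_
  have hposLog : log⁺ ‖L s‖ ≤ ‖L s‖ :=
    max_le (norm_nonneg _) (Real.log_le_self (norm_nonneg _))
  have hterm (k : ℕ) : log⁺ ‖P.coeff k s * L s ^ k‖ ≤ log⁺ (M k) + k * ‖L s‖ := by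
    rw [norm_mul, norm_pow]
    refine Real.posLog_mul.trans ?_
    rw [Real.posLog_pow]
    gcongr
    exact hM k s h₁ h₂
  calc log⁺ ‖polyComp P L s‖ = log⁺ ‖∑ k ∈ J, P.coeff k s * L s ^ k‖ := by
        rw [polyComp_eq_sum, Finset.sum_apply]; rfl
    _ ≤ Real.log J.card + ∑ k ∈ J, log⁺ ‖P.coeff k s * L s ^ k‖ := Real.posLog_norm_sum_le J _
    _ ≤ Real.log J.card + ∑ k ∈ J, (log⁺ (M k) + k * ‖L s‖) := by
        gcongr with k; exact hterm k
    _ = Real.log J.card + ∑ k ∈ J, log⁺ (M k) + (∑ k ∈ J, (k : ℝ)) * ‖L s‖ := by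
        rw [Finset.sum_add_distrib, Finset.sum_mul, add_assoc]

end PolyComp

section Zeros

variable {F : ℂ → ℂ}

/-- The number of zeros of `F` in `A`, counted with multiplicity. -/
noncomputable def zeroCountOn (F : ℂ → ℂ) (A : Set ℂ) : ℝ≥0∞ :=
  ∑' ρ : A, ((zeroMult F ρ : ℕ∞) : ℝ≥0∞)

theorem zeroCountOn_mono {A B : Set ℂ} (h : A ⊆ B) : zeroCountOn F A ≤ zeroCountOn F B :=
  ENNReal.tsum_mono_subtype (fun ρ => ((zeroMult F ρ : ℕ∞) : ℝ≥0∞)) h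

theorem zeroCountOn_union_le (A B : Set ℂ) :
    zeroCountOn F (A ∪ B) ≤ zeroCountOn F A + zeroCountOn F B :=
  ENNReal.tsum_union_le (fun ρ => ((zeroMult F ρ : ℕ∞) : ℝ≥0∞)) A B

theorem zeroCountOn_biUnion_le {ι : Type*} (s : Finset ι) (A : ι → Set ℂ) :
    zeroCountOn F (⋃ i ∈ s, A i) ≤ ∑ i ∈ s, zeroCountOn F (A i) :=
  ENNReal.tsum_biUnion_le (fun ρ => ((zeroMult F ρ : ℕ∞) : ℝ≥0∞)) s A

theorem zeroMult_eq_zero {z : ℂ} (hF : AnalyticAt ℂ F z) (h : F z ≠ 0) : zeroMult F z = 0 := by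
  rw [zeroMult, hF.meromorphicOrderAt_eq, hF.analyticOrderAt_eq_zero.2 h]
  rfl

theorem zeroCountOn_eq_zero {A : Set ℂ} (hF : AnalyticOnNhd ℂ F A) (h : ∀ z ∈ A, F z ≠ 0) :
    zeroCountOn F A = 0 :=
  ENNReal.tsum_eq_zero.2 fun z => by simp [zeroMult_eq_zero (hF z z.2) (h z z.2)]

theorem zeroMult_eq_toNat_divisor {K : Set ℂ} (hF : MeromorphicOn F K) {z : ℂ} (hz : z ∈ K)
    (h : meromorphicOrderAt F z ≠ ⊤) :
    zeroMult F z = ((MeromorphicOn.divisor F K z).toNat : ℕ∞) := by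
  rw [hF.divisor_apply hz, zeroMult]
  lift meromorphicOrderAt F z to ℤ using h with k
  rfl

theorem zeroCountOn_eq_sum_divisor {K : Set ℂ} (hK : IsCompact K) (hF : MeromorphicOn F K)
    (h : ∀ z ∈ K, meromorphicOrderAt F z ≠ ⊤) :
    zeroCountOn F K = ∑ u ∈ ((MeromorphicOn.divisor F K).finiteSupport hK).toFinset,
      ((MeromorphicOn.divisor F K u).toNat : ℝ≥0∞) := by
  have hind (u : ℂ) : K.indicator (fun ρ => ((zeroMult F ρ : ℕ∞) : ℝ≥0∞)) u =
      ((MeromorphicOn.divisor F K u).toNat : ℝ≥0∞) := by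
    by_cases hu : u ∈ K
    · rw [Set.indicator_of_mem hu, zeroMult_eq_toNat_divisor hF hu (h u hu)]
      rfl
    · simp [hu]
  rw [zeroCountOn, tsum_subtype K fun ρ => ((zeroMult F ρ : ℕ∞) : ℝ≥0∞), tsum_congr hind]
  refine tsum_eq_sum fun u hu => ?_
  have hu₀ : MeromorphicOn.divisor F K u = 0 := by simpa using hu
  simp [hu₀]

theorem zeroCountOn_ne_top {K : Set ℂ} (hK : IsCompact K) (hF : MeromorphicOn F K)
    (h : ∀ z ∈ K, meromorphicOrderAt F z ≠ ⊤) : zeroCountOn F K ≠ ⊤ := by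
  rw [zeroCountOn_eq_sum_divisor hK hF h]
  exact ENNReal.sum_ne_top.2 fun u _ => ENNReal.natCast_ne_top _

theorem meromorphicOrderAt_ne_top_of_analyticAt {U : Set ℂ} (hF : MeromorphicOn F U)
    (hU : IsPreconnected U) {c : ℂ} (hc : c ∈ U) (hFc : AnalyticAt ℂ F c) (h₀ : F c ≠ 0) :
    ∀ z ∈ U, meromorphicOrderAt F z ≠ ⊤ := by
  intro z hz
  refine hF.meromorphicOrderAt_ne_top_of_isPreconnected hU hc hz ?_
  rw [hFc.meromorphicOrderAt_eq, hFc.analyticOrderAt_eq_zero.2 h₀]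
  exact WithTop.zero_ne_top

open scoped Real in
theorem zeroCountOn_closedBall_le {c : ℂ} {r R B : ℝ} (hr : 0 < r) (hrR : r < R) (hB : 0 ≤ B)
    (hF : AnalyticOnNhd ℂ F (Metric.closedBall c R)) (h₀ : F c ≠ 0)
    (hb : ∀ z ∈ Metric.sphere c R, log⁺ ‖F z‖ ≤ B) :
    zeroCountOn F (Metric.closedBall c r) ≤
      ENNReal.ofReal ((B - Real.log ‖F c‖) / Real.log (R / r)) := by
  have hF' : AnalyticOnNhd ℂ F (Metric.closedBall c r) :=
    hF.mono (Metric.closedBall_subset_closedBall hrR.le)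
  have hc : c ∈ Metric.closedBall c r := Metric.mem_closedBall_self hr.le
  have hnonneg (u : ℂ) : 0 ≤ MeromorphicOn.divisor F (Metric.closedBall c r) u :=
    MeromorphicOn.AnalyticOnNhd.divisor_nonneg hF' u
  have hexp (z : ℂ) (hz : z ∈ Metric.sphere c R) : ‖F z‖ ≤ Real.exp B :=
    (Real.le_exp_log _).trans (Real.exp_le_exp.2 ((le_max_right _ _).trans (hb z hz)))
  have hJensen := AnalyticOnNhd.sum_divisor_le (c := c) (r := r) (R := R) (f := F)
    (M := Real.exp B)
  rw [abs_of_pos hr, abs_of_pos (hr.trans hrR)] at hJensen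
  replace hJensen := hJensen hr hrR (Real.one_le_exp hB) hF h₀ hexp
  rw [Real.log_div (Real.exp_ne_zero B) (norm_ne_zero_iff.2 h₀), Real.log_exp] at hJensen
  refine le_trans (le_of_eq ?_) (ENNReal.ofReal_le_ofReal hJensen)
  have hK := isCompact_closedBall c r
  rw [zeroCountOn_eq_sum_divisor hK hF'.meromorphicOn (meromorphicOrderAt_ne_top_of_analyticAt
      hF'.meromorphicOn (convex_closedBall c r).isPreconnected hc (hF' c hc) h₀),
    finsum_eq_sum _ ((MeromorphicOn.divisor F (Metric.closedBall c r)).finiteSupport hK),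
    Int.cast_sum, ENNReal.ofReal_sum_of_nonneg fun u _ => by exact_mod_cast hnonneg u]
  refine Finset.sum_congr rfl fun u _ => ?_
  lift MeromorphicOn.divisor F (Metric.closedBall c r) u to ℕ using hnonneg u with k
  simp

theorem mem_closedBall_add_floor {σ₀ X r : ℝ} (hr : 0 ≤ r) (hXr : (X - σ₀) ^ 2 + 1 ≤ r ^ 2)
    {ρ : ℂ} (hσ₀ : σ₀ < ρ.re) (hX : ρ.re < X) (him : 0 ≤ ρ.im) :
    ρ ∈ Metric.closedBall ((X : ℂ) + (⌊ρ.im⌋₊ : ℝ) * I) r := by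
  have hfloor := Nat.floor_le him
  have hfloor' := Nat.lt_floor_add_one ρ.im
  rw [mem_closedBall_iff_norm, ← sq_le_sq₀ (norm_nonneg _) hr, Complex.sq_norm, normSq_apply]
  simp only [sub_re, add_re, re_ofReal_mul, ofReal_re, I_re, mul_zero, add_zero, sub_im, add_im,
    im_ofReal_mul, ofReal_im, I_im, mul_one, zero_add]
  nlinarith

theorem setOf_re_im_subset_union {σ₀ X r : ℝ} (hr : 0 ≤ r) (hXr : (X - σ₀) ^ 2 + 1 ≤ r ^ 2)
    (n₀ : ℕ) (T : ℝ) :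
    {ρ : ℂ | σ₀ < ρ.re ∧ 0 < ρ.im ∧ ρ.im < T} ⊆
      {ρ | X ≤ ρ.re} ∪ (Set.Icc σ₀ X ×ℂ Set.Icc 0 (n₀ : ℝ) ∪
        ⋃ n ∈ Finset.Ico n₀ ⌈T⌉₊, Metric.closedBall ((X : ℂ) + (n : ℝ) * I) r) := by
  rintro ρ ⟨hσ₀, him, hT⟩
  rcases le_or_gt X ρ.re with hX | hX
  · exact .inl hX
  rcases le_or_gt ρ.im n₀ with hn₀ | hn₀
  · exact .inr (.inl ⟨⟨hσ₀.le, hX.le⟩, him.le, hn₀⟩)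
  have hfloor : ⌊ρ.im⌋₊ ∈ Finset.Ico n₀ ⌈T⌉₊ :=
    Finset.mem_Ico.2 ⟨Nat.le_floor hn₀.le,
      Nat.cast_lt.1 ((Nat.floor_le him.le).trans_lt (hT.trans_le (Nat.le_ceil T)))⟩
  exact .inr (.inr (Set.mem_biUnion hfloor (mem_closedBall_add_floor hr hXr hσ₀ hX him.le)))

theorem exists_add_sum_le_ofReal_mul {β : ℕ → ℝ} (hβ : ∀ n, 0 ≤ β n)
    (hsum : (fun N : ℕ => ∑ n ∈ Finset.range N, β n) =O[atTop] fun N => (N : ℝ))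
    {κ : ℝ≥0∞} (hκ : κ ≠ ⊤) :
    ∃ C T₀ : ℝ, ∀ T : ℝ, T₀ ≤ T →
      κ + ∑ n ∈ Finset.range ⌈T⌉₊, ENNReal.ofReal (β n) ≤ ENNReal.ofReal (C * T) := by
  have hceil : (fun T : ℝ => (⌈T⌉₊ : ℝ)) =O[atTop] fun T => T :=
    Asymptotics.isEquivalent_nat_ceil.isBigO
  have hlinear : (fun T : ℝ => κ.toReal + ∑ n ∈ Finset.range ⌈T⌉₊, β n) =O[atTop] fun T => T :=
    (Asymptotics.isLittleO_const_id_atTop _).isBigO.add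
      ((hsum.comp_tendsto tendsto_nat_ceil_atTop).trans hceil)
  obtain ⟨C, hC⟩ := hlinear.bound
  obtain ⟨T₀, hT₀⟩ := eventually_atTop.1 (hC.and (eventually_ge_atTop 0))
  refine ⟨C, T₀, fun T hT => ?_⟩
  obtain ⟨hbound, hT⟩ := hT₀ T hT
  rw [← ENNReal.ofReal_toReal hκ, ← ENNReal.ofReal_sum_of_nonneg fun n _ => hβ n,
    ← ENNReal.ofReal_add ENNReal.toReal_nonneg (Finset.sum_nonneg fun n _ => hβ n)]
  refine ENNReal.ofReal_le_ofReal ((le_abs_self _).trans (hbound.trans_eq ?_))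
  rw [Real.norm_of_nonneg hT]

theorem exists_zeroCount_le_mul {σ₀ X r : ℝ} (hr : 0 ≤ r) (hXr : (X - σ₀) ^ 2 + 1 ≤ r ^ 2)
    (hright : zeroCountOn F {ρ | X ≤ ρ.re} = 0)
    (hrect : ∀ y : ℝ, zeroCountOn F (Set.Icc σ₀ X ×ℂ Set.Icc 0 y) ≠ ⊤)
    {β : ℕ → ℝ} (hβ : ∀ n, 0 ≤ β n)
    (hsum : (fun N : ℕ => ∑ n ∈ Finset.range N, β n) =O[atTop] fun N => (N : ℝ))
    (hdisc : ∀ᶠ n : ℕ in atTop,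
      zeroCountOn F (Metric.closedBall ((X : ℂ) + (n : ℝ) * I) r) ≤ ENNReal.ofReal (β n)) :
    ∃ C T₀ : ℝ, ∀ T : ℝ, T₀ ≤ T → zeroCount F σ₀ T ≤ ENNReal.ofReal (C * T) := by
  obtain ⟨n₀, hn₀⟩ := eventually_atTop.1 hdisc
  obtain ⟨C, T₀, hC⟩ := exists_add_sum_le_ofReal_mul hβ hsum (hrect n₀)
  refine ⟨C, T₀, fun T hT => le_trans ?_ (hC T hT)⟩
  set K : Set ℂ := Set.Icc σ₀ X ×ℂ Set.Icc 0 (n₀ : ℝ)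
  set D : ℕ → Set ℂ := fun n => Metric.closedBall ((X : ℂ) + (n : ℝ) * I) r
  set J := Finset.Ico n₀ ⌈T⌉₊
  have hJ : J ⊆ Finset.range ⌈T⌉₊ := fun n hn => Finset.mem_range.2 (Finset.mem_Ico.1 hn).2
  calc zeroCount F σ₀ T
      ≤ zeroCountOn F ({ρ | X ≤ ρ.re} ∪ (K ∪ ⋃ n ∈ J, D n)) :=
        zeroCountOn_mono (setOf_re_im_subset_union hr hXr n₀ T)
    _ ≤ zeroCountOn F {ρ | X ≤ ρ.re} + (zeroCountOn F K + zeroCountOn F (⋃ n ∈ J, D n)) :=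
        (zeroCountOn_union_le _ _).trans (by gcongr; exact zeroCountOn_union_le _ _)
    _ = zeroCountOn F K + zeroCountOn F (⋃ n ∈ J, D n) := by rw [hright, zero_add]
    _ ≤ zeroCountOn F K + ∑ n ∈ J, ENNReal.ofReal (β n) := by
        gcongr
        exact (zeroCountOn_biUnion_le J D).trans
          (Finset.sum_le_sum fun n hn => hn₀ n (Finset.mem_Ico.1 hn).1)
    _ ≤ zeroCountOn F K + ∑ n ∈ Finset.range ⌈T⌉₊, ENNReal.ofReal (β n) := by gcongr

end Zeros

section ZeroDensity

open scoped Real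

variable {F : ℂ → ℂ} {S : Finset ℂ}

theorem isPreconnected_rightHalfPlane : IsPreconnected rightHalfPlane :=
  (convex_halfSpace_re_gt _).isPreconnected

theorem frequently_ne_zero_of_meromorphicOrderAt_ne_top (hF : MeromorphicOn F rightHalfPlane)
    (hord : ∀ z ∈ rightHalfPlane, meromorphicOrderAt F z ≠ ⊤) :
    ∃ᶠ s in comap re atTop, F s ≠ 0 := by
  intro h
  obtain ⟨σ, hσ⟩ := eventually_comap_re_atTop.1 h
  obtain ⟨x, hx, hxσ⟩ := ((eventually_gt_atTop (1 / 2 : ℝ)).and (eventually_gt_atTop σ)).exists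
  have hmem : (x : ℂ) ∈ rightHalfPlane := by simpa [rightHalfPlane] using hx
  have hzero : ∀ᶠ s in 𝓝[≠] (x : ℂ), F s = 0 := by
    filter_upwards [nhdsWithin_le_nhds (continuous_re.continuousAt.eventually
      (lt_mem_nhds (by simpa using hxσ)))] with s hs
    exact not_not.1 (hσ s hs)
  have hne := (meromorphicOrderAt_ne_top_iff_eventually_ne_zero (hF _ hmem)).1 (hord _ hmem)
  obtain ⟨s, hs₀, hs⟩ := (hzero.and hne).exists
  exact hs hs₀

theorem bounds_of_mem_closedBall {X y R : ℝ} {z : ℂ}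
    (hz : z ∈ Metric.closedBall ((X : ℂ) + y * I) R) :
    X - R ≤ z.re ∧ z.re ≤ X + R ∧ |z.im - y| ≤ R := by
  rw [mem_closedBall_iff_norm] at hz
  have hre : |z.re - X| ≤ R := by simpa using (abs_re_le_norm _).trans hz
  have him : |z.im - y| ≤ R := by simpa using (abs_im_le_norm _).trans hz
  rw [abs_le] at hre
  exact ⟨by linarith, by linarith, him⟩

theorem eventually_closedBall_subset_diff (S : Finset ℂ) {X R : ℝ} (h : 1 / 2 < X - R) :
    ∀ᶠ y : ℝ in atTop,
      Metric.closedBall ((X : ℂ) + y * I) R ⊆ rightHalfPlane \ (S : Set ℂ) := by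
  filter_upwards [(Finset.eventually_all S).2 fun s _ => eventually_gt_atTop (s.im + R)]
    with y hy z hz
  obtain ⟨hre, -, him⟩ := bounds_of_mem_closedBall hz
  exact ⟨h.trans_le hre, fun hzS => by linarith [hy z hzS, (abs_le.1 him).1]⟩

theorem BoundedOnAverage.exists_zeroCountOn_closedBall_le {X r R c : ℝ}
    (hF : BoundedOnAverage (fun s => log⁺ ‖F s‖) (X - R) (X + R) R)
    (hhol : DifferentiableOn ℂ F (rightHalfPlane \ (S : Set ℂ))) (hr : 0 < r) (hrR : r < R)
    (hXR : 1 / 2 < X - R) (hc : 0 < c) (hlow : ∀ y : ℝ, c ≤ ‖F (X + y * I)‖) :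
    ∃ β : ℕ → ℝ, (∀ n, 0 ≤ β n) ∧
      ((fun N : ℕ => ∑ n ∈ Finset.range N, β n) =O[atTop] fun N => (N : ℝ)) ∧
      ∀ᶠ n : ℕ in atTop, zeroCountOn F (Metric.closedBall ((X : ℂ) + (n : ℝ) * I) r) ≤
        ENNReal.ofReal (β n) := by
  obtain ⟨B, hB, hsum, hbound⟩ := hF
  have hlog : 0 < Real.log (R / r) := Real.log_pos ((one_lt_div hr).2 hrR)
  refine ⟨fun n => |Real.log c| / Real.log (R / r) + 1 / Real.log (R / r) * B n, fun n => ?_,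
    sum_add_mul_isBigO hsum _ _, ?_⟩
  · have hBn := hB n
    positivity
  filter_upwards [hbound,
    tendsto_natCast_atTop_atTop.eventually (eventually_closedBall_subset_diff S hXR)] with n hn hsub
  have hsphere (z : ℂ) (hz : z ∈ Metric.sphere ((X : ℂ) + (n : ℝ) * I) R) : log⁺ ‖F z‖ ≤ B n := by
    obtain ⟨h₁, h₂, h₃⟩ := bounds_of_mem_closedBall (Metric.sphere_subset_closedBall hz)
    exact hn z h₁ h₂ h₃
  have hcn : 0 < ‖F (X + (n : ℝ) * I)‖ := hc.trans_le (hlow n)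
  refine (zeroCountOn_closedBall_le hr hrR (hB n)
    ((hhol.analyticOnNhd (isOpen_rightHalfPlane_diff S)).mono hsub) (norm_pos_iff.1 hcn)
    hsphere).trans (ENNReal.ofReal_le_ofReal ?_)
  rw [one_div_mul_eq_div, ← add_div]
  gcongr
  linarith [Real.log_le_log hc (hlow n), neg_le_abs (Real.log c)]

theorem eventually_sq_sub_add_one_le (σ₀ : ℝ) {δ : ℝ} (hδ : 0 < δ) :
    ∀ᶠ X : ℝ in atTop, (X - σ₀) ^ 2 + 1 ≤ (X - σ₀ + δ) ^ 2 := by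
  filter_upwards [eventually_ge_atTop (σ₀ + 1 / (2 * δ))] with X hX
  have h : 1 ≤ (X - σ₀) * (2 * δ) := (div_le_iff₀ (by positivity)).1 (by linarith)
  nlinarith [sq_nonneg δ]

theorem exists_zeroCount_le_mul_of_boundedOnAverage (hGDS : IsEventuallyGDS F)
    (hmer : MeromorphicOn F rightHalfPlane)
    (hhol : DifferentiableOn ℂ F (rightHalfPlane \ (S : Set ℂ)))
    (hne : ∃ s ∈ rightHalfPlane \ (S : Set ℂ), F s ≠ 0)
    (hF : ∀ σ₁ σ₂ h : ℝ, 1 / 2 < σ₁ → BoundedOnAverage (fun s => log⁺ ‖F s‖) σ₁ σ₂ h)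
    {σ₀ : ℝ} (hσ₀ : 1 / 2 < σ₀) :
    ∃ C T₀ : ℝ, ∀ T : ℝ, T₀ ≤ T → zeroCount F σ₀ T ≤ ENNReal.ofReal (C * T) := by
  have han := hhol.analyticOnNhd (isOpen_rightHalfPlane_diff S)
  have hord : ∀ z ∈ rightHalfPlane, meromorphicOrderAt F z ≠ ⊤ := by
    obtain ⟨s, hs, hFs⟩ := hne
    exact meromorphicOrderAt_ne_top_of_analyticAt hmer isPreconnected_rightHalfPlane hs.1
      (han s hs) hFs
  obtain ⟨c, μ, hc, hlow⟩ :=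
    hGDS.exists_lower_bound (frequently_ne_zero_of_meromorphicOrderAt_ne_top hmer hord)
  obtain ⟨σ₁, hσ₁⟩ := eventually_comap_re_atTop.1 hlow
  obtain ⟨δ, hδ, hδσ₀⟩ : ∃ δ : ℝ, 0 < δ ∧ 1 / 2 < σ₀ - 2 * δ :=
    ⟨(σ₀ - 1 / 2) / 4, by linarith, by linarith⟩
  obtain ⟨X, hXS, hXσ₁, hXσ₀, hXδ⟩ := (((Finset.eventually_all S).2
    fun s _ => eventually_gt_atTop s.re).and ((eventually_gt_atTop σ₁).and
      ((eventually_gt_atTop σ₀).and (eventually_sq_sub_add_one_le σ₀ hδ)))).exists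
  have hright : zeroCountOn F {ρ | X ≤ ρ.re} = 0 := by
    refine zeroCountOn_eq_zero (han.mono fun s (hs : X ≤ s.re) => ⟨?_, fun hsS => ?_⟩)
      fun s (hs : X ≤ s.re) => ?_
    · exact (hσ₀.trans hXσ₀).trans_le hs
    · exact (hXS s hsS).not_ge hs
    · exact norm_pos_iff.1 ((by positivity : 0 < c * Real.exp (-μ * s.re)).trans_le
        (hσ₁ s (hXσ₁.trans_le hs)))
  have hrect (y : ℝ) : zeroCountOn F (Set.Icc σ₀ X ×ℂ Set.Icc 0 y) ≠ ⊤ := by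
    have hsub : Set.Icc σ₀ X ×ℂ Set.Icc 0 y ⊆ rightHalfPlane := fun z hz => hσ₀.trans_le hz.1.1
    exact zeroCountOn_ne_top (isCompact_Icc.reProdIm isCompact_Icc) (hmer.mono_set hsub)
      fun z hz => hord z (hsub hz)
  have hXR : 1 / 2 < X - (X - σ₀ + 2 * δ) := by linarith
  obtain ⟨β, hβ, hsum, hdisc⟩ := (hF _ _ _ hXR).exists_zeroCountOn_closedBall_le
    (r := X - σ₀ + δ) (c := c * Real.exp (-μ * X)) hhol (by linarith) (by linarith) hXR
    (by positivity) fun y => by simpa using hσ₁ (X + y * I) (by simpa using hXσ₁)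
  exact exists_zeroCount_le_mul (by linarith) hXδ hright hrect hβ hsum hdisc

end ZeroDensity

theorem frequently_isBigO_integral_norm {L : ℂ → ℂ} {S : Finset ℂ} (hS : ∀ s ∈ S, s.re = 1)
    (hhol : DifferentiableOn ℂ L (rightHalfPlane \ (S : Set ℂ)))
    (hmean : ∀ σ : ℝ, 1 / 2 < σ → σ < 1 →
      (fun T : ℝ => ∫ t in (0 : ℝ)..T, ‖L ((σ : ℂ) + (t : ℂ) * I)‖ ^ 2)
        =O[atTop] (fun T : ℝ => T)) :
    ∃ᶠ σ : ℝ in 𝓝[>] (1 / 2),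
      (fun T : ℝ => ∫ t in (0 : ℝ)..T, ‖L ((σ : ℂ) + (t : ℂ) * I)‖) =O[atTop] fun T => T := by
  refine Eventually.frequently ?_
  filter_upwards [Ioo_mem_nhdsGT (by norm_num : (1 / 2 : ℝ) < 1)] with σ ⟨hσ, hσ₁⟩
  have hcont := continuous_verticalLine hhol hσ fun s hs => (hS s hs).trans_ne hσ₁.ne'
  have hsq : Continuous fun t : ℝ => ‖L (σ + t * I)‖ ^ 2 := hcont.norm.pow 2
  refine .trans (.of_bound' ?_) ((Asymptotics.isBigO_refl _ _).add (hmean σ hσ hσ₁))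
  filter_upwards [eventually_ge_atTop 0] with T hT
  rw [Real.norm_of_nonneg (intervalIntegral.integral_nonneg hT fun t _ => norm_nonneg _)]
  calc ∫ t in (0 : ℝ)..T, ‖L (σ + t * I)‖ ≤ ∫ t in (0 : ℝ)..T, (1 + ‖L (σ + t * I)‖ ^ 2) :=
        intervalIntegral.integral_mono_on hT (hcont.norm.intervalIntegrable _ _)
          ((continuous_const.add hsq).intervalIntegrable _ _)
          fun t _ => by nlinarith [sq_nonneg (‖L (σ + t * I)‖ - 1)]
    _ = T + ∫ t in (0 : ℝ)..T, ‖L (σ + t * I)‖ ^ 2 := by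
        rw [intervalIntegral.integral_add intervalIntegrable_const
          (hsq.intervalIntegrable _ _)]
        simp
    _ ≤ ‖T + ∫ t in (0 : ℝ)..T, ‖L (σ + t * I)‖ ^ 2‖ := le_abs_self _

theorem theorem2_general
    (L : ℂ → ℂ) (hL : IsEventuallyGDS L) (S : Finset ℂ)
    (hmer : MeromorphicOn L rightHalfPlane)
    (hhol : DifferentiableOn ℂ L (rightHalfPlane \ (S : Set ℂ)))
    (hord : HasFiniteOrder L)
    (hmean : ∃ᶠ σ : ℝ in 𝓝[>] (1 / 2),
      (fun T : ℝ => ∫ t in (0 : ℝ)..T, ‖L ((σ : ℂ) + (t : ℂ) * I)‖) =O[atTop] fun T => T)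
    (P : Polynomial (ℂ → ℂ)) (hP : ∀ k : ℕ, IsAbsConvGDS (P.coeff k))
    (hne : ∃ s ∈ rightHalfPlane \ (S : Set ℂ), polyComp P L s ≠ 0)
    (σ₀ : ℝ) (hσ₀ : 1 / 2 < σ₀) :
    ∃ C T₀ : ℝ, ∀ T : ℝ, T₀ ≤ T →
      zeroCount (polyComp P L) σ₀ T ≤ ENNReal.ofReal (C * T) :=
  exists_zeroCount_le_mul_of_boundedOnAverage (hL.polyComp hP) (meromorphicOn_polyComp hP hmer)
    (differentiableOn_polyComp hP Set.sdiff_subset hhol) hne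
    (fun _ σ₂ h hσ₁ =>
      (boundedOnAverage_norm hL hhol hord hmean hσ₁ σ₂ h).posLog_norm_polyComp hP hσ₁) hσ₀

theorem theorem2
    (L : ℂ → ℂ)
    (hDir : IsDirichletSeriesRightOfOne L)
    (S : Finset ℂ) (hS : ∀ s ∈ S, s.re = 1)
    (hmer : MeromorphicOn L rightHalfPlane)
    (hhol : DifferentiableOn ℂ L (rightHalfPlane \ (S : Set ℂ)))
    (hord : HasFiniteOrder L)
    (hmean : ∀ σ : ℝ, 1 / 2 < σ → σ < 1 →
      (fun T : ℝ => ∫ t in (0 : ℝ)..T, ‖L ((σ : ℂ) + (t : ℂ) * Complex.I)‖ ^ 2)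
        =O[atTop] (fun T : ℝ => T))
    (P : Polynomial (ℂ → ℂ)) (hP : ∀ k : ℕ, IsAbsConvGDS (P.coeff k))
    (hne : ∃ s ∈ rightHalfPlane \ (S : Set ℂ), polyComp P L s ≠ 0)
    (σ₀ : ℝ) (hσ₀ : 1 / 2 < σ₀) :
    ∃ C T₀ : ℝ, ∀ T : ℝ, T₀ ≤ T →
      zeroCount (polyComp P L) σ₀ T ≤ ENNReal.ofReal (C * T) := by
  have hmean₁ := frequently_isBigO_integral_norm hS hhol hmean
  exact theorem2_general L hDir.isEventuallyGDS S hmer hhol hord hmean₁ P hP hne σ₀ hσ₀
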